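/- Let $R$ be a ring (associative with unit), let $A$ be a left $R$-module and let $I_0,\dots,I_n$ ($n\ge 0$) be submodules of $A$. For $q\ge 0$ let $C^q(I_0,\dots,I_n)$ be the left $R$-module of families $(i_{\alpha_0\ldots\alpha_q})\in\prod_{0\le\alpha_0,\dots,\alpha_q\le n}(I_{\alpha_0}+\dots+I_{\alpha_q})$ which are completely alternating in the indices, i.e. the sum of two entries whose index sequences differ by interchanging two positions is $0$, and every entry with a repeated index is $0$; with the coboundary $(di)_{\alpha_0\ldots\alpha_{q+1}}=\sum_{p=0}^{q+1}(-1)^p\, i_{\alpha_0\ldots\widehat{\alpha_p}\ldots\alpha_{q+1}}$ they form a cochain complex $C^\bullet(I_0,\dots,I_n)$ of left $R$-modules. (1) Suppose that $R$ is left Noetherian and left hereditary (every left ideal is projective), that $A$ is distributive (i.e. its lattice of submodules is distributive), and that the modules $I_0,\dots,I_n$ are injective. Then for every $q\ge 0$ there is an isomorphism of abelian groups, natural in the left $R$-module $M$, $$\mathrm{Ext}^q_R(M,\,I_0\cap\dots\cap I_n)\;\cong\;\mathrm{H}^q\big(\mathrm{Hom}_R(M,\,C^\bullet(I_0,\dots,I_n))\big).$$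 (2) Suppose that $R$ is a (commutative) Dedekind domain, fields being allowed, that $A$ is distributive, finitely generated and non-singular (no nonzero element of $A$ is annihilated by an essential ideal of $R$), and that the modules $I_0,\dots,I_n$ are injective. Then for every $q>0$ and every $R$-module $M$ $$\mathrm{H}^q\big(\mathrm{Hom}_R(M,\,C^\bullet(I_0,\dots,I_n))\big)=0.$$ -/

import Mathlib

open CategoryTheory

universe u v

/-- A left ideal of `R` is essential if it meets every nonzero left ideal nontrivially. -/
def IsEssentialLeftIdeal {R : Type u} [Ring R] (E : Ideal R) : Prop :=
  ∀ J : Ideal R, J ≠ ⊥ → E ⊓ J ≠ ⊥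

/-- A left module is non-singular if no nonzero element of it is annihilated by an essential
left ideal. -/
def IsNonsingularModule (R : Type u) [Ring R] (A : Type v) [AddCommGroup A] [Module R A] : Prop :=
  ∀ a : A, (∃ E : Ideal R, IsEssentialLeftIdeal E ∧ ∀ r ∈ E, r • a = 0) → a = 0

/-- A ring is left hereditary if all its left ideals are projective left modules. -/
def IsLeftHereditary (R : Type u) [Ring R] : Prop :=
  ∀ J : Ideal R, Module.Projective R J

/-- A left module is distributive if its lattice of submodules is distributive. -/
def IsDistributiveModule (R : Type u) [Ring R] (A : Type v) [AddCommGroup A] [Module R A] : Prop :=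
  ∀ X Y Z : Submodule R A, X ⊓ (Y ⊔ Z) = (X ⊓ Y) ⊔ (X ⊓ Z)

section Cochains

variable {R : Type u} [Ring R] {A : Type v} [AddCommGroup A] [Module R A]
  {n : ℕ} (I : Fin (n + 1) → Submodule R A)

/-- The module of `q`-cochains: families of elements
`i α ∈ I (α 0) + ⋯ + I (α q)`, indexed by all sequences `α` of `q + 1` indices, which are
completely alternating in these indices. -/
def sumCochains (q : ℕ) : Submodule R ((Fin (q + 1) → Fin (n + 1)) → A) where
  carrier := {i | (∀ α, i α ∈ ⨆ k, I (α k)) ∧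
    (∀ (α : Fin (q + 1) → Fin (n + 1)) (j k : Fin (q + 1)), j ≠ k →
      i α + i (α ∘ Equiv.swap j k) = 0) ∧
    (∀ (α : Fin (q + 1) → Fin (n + 1)) (j k : Fin (q + 1)), j ≠ k → α j = α k → i α = 0)}
  zero_mem' := ⟨fun _ => Submodule.zero_mem _, fun _ _ _ _ => by simp, fun _ _ _ _ _ => rfl⟩
  add_mem' := by
    rintro x y ⟨hx1, hx2, hx3⟩ ⟨hy1, hy2, hy3⟩
    refine ⟨fun α => Submodule.add_mem _ (hx1 α) (hy1 α), fun α j k h => ?_, fun α j k h e => ?_⟩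
    · have := congrArg₂ (· + ·) (hx2 α j k h) (hy2 α j k h)
      simp only [Pi.add_apply, add_zero] at this ⊢
      rw [← this]
      abel
    · simp [hx3 α j k h e, hy3 α j k h e]
  smul_mem' := by
    rintro c x ⟨hx1, hx2, hx3⟩
    refine ⟨fun α => Submodule.smul_mem _ c (hx1 α), fun α j k h => ?_, fun α j k h e => ?_⟩
    · simp only [Pi.smul_apply, ← smul_add, hx2 α j k h, smul_zero]
    · simp [hx3 α j k h e]

/-- The coboundary on families indexed by all sequences of indices. -/
def sumCoboundaryAux (R : Type u) [Ring R] (A : Type v) [AddCommGroup A] [Module R A] (n q : ℕ) :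
    ((Fin (q + 1) → Fin (n + 1)) → A) →ₗ[R] ((Fin (q + 2) → Fin (n + 1)) → A) where
  toFun i := fun α => ∑ p : Fin (q + 2), (-1 : ℤ) ^ (p : ℕ) • i (α ∘ p.succAbove)
  map_add' x y := by
    funext α
    simp [Finset.sum_add_distrib]
  map_smul' c x := by
    funext α
    simp only [Pi.smul_apply, RingHom.id_apply, Finset.smul_sum]
    exact Finset.sum_congr rfl fun p _ => smul_comm _ _ _

theorem sumCoboundaryAux_apply {q : ℕ} (i : (Fin (q + 1) → Fin (n + 1)) → A)
    (α : Fin (q + 2) → Fin (n + 1)) :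
    sumCoboundaryAux R A n q i α =
      ∑ p : Fin (q + 2), (-1 : ℤ) ^ (p : ℕ) • i (α ∘ p.succAbove) := rfl

theorem sumCochains_perm {q : ℕ} {i : (Fin (q + 1) → Fin (n + 1)) → A}
    (hi : i ∈ sumCochains I q) (σ : Equiv.Perm (Fin (q + 1))) :
    ∀ α : Fin (q + 1) → Fin (n + 1), i (α ∘ σ) = (Equiv.Perm.sign σ : ℤ) • i α := by
  induction σ using Equiv.Perm.swap_induction_on with
  | one => intro α; simp
  | swap_mul f x y hxy ih =>
    intro α
    have h1 := ih (α ∘ Equiv.swap x y)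
    have h2 := eq_neg_of_add_eq_zero_right (hi.2.1 α x y hxy)
    have h3 : α ∘ ⇑(Equiv.swap x y * f) = (α ∘ Equiv.swap x y) ∘ f := rfl
    rw [h3, h1, h2, Equiv.Perm.sign_mul, Equiv.Perm.sign_swap hxy]
    simp

theorem sumCoboundary_term_perm {q : ℕ} {i : (Fin (q + 1) → Fin (n + 1)) → A}
    (hi : i ∈ sumCochains I q) (τ : Equiv.Perm (Fin (q + 2))) (α : Fin (q + 2) → Fin (n + 1))
    (p : Fin (q + 2)) :
    (-1 : ℤ) ^ (p : ℕ) • i ((α ∘ τ) ∘ p.succAbove) =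
      (Equiv.Perm.sign τ : ℤ) • ((-1 : ℤ) ^ ((τ p : Fin (q + 2)) : ℕ) •
        i (α ∘ (τ p).succAbove)) := by
  obtain ⟨⟨a, ρ⟩, hρ⟩ := Equiv.Perm.decomposeFin.symm.surjective
    ((τ p).cycleRange * τ * p.cycleRange⁻¹)
  have ha : a = 0 := by
    have := congrArg (fun f : Equiv.Perm (Fin (q + 2)) => f 0) hρ
    simpa [Equiv.Perm.inv_def] using this
  subst ha
  have hsign := congrArg (fun f : Equiv.Perm (Fin (q + 2)) => (Equiv.Perm.sign f : ℤ)) hρ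
  simp only [Equiv.Perm.decomposeFin.symm_sign, Equiv.Perm.sign_mul, Equiv.Perm.sign_inv,
    Fin.sign_cycleRange, if_true, one_mul] at hsign
  push_cast at hsign
  have hcomp : (α ∘ τ) ∘ p.succAbove = (α ∘ (τ p).succAbove) ∘ ρ := by
    funext k
    have h1 := congrArg (fun f : Equiv.Perm (Fin (q + 2)) => (τ p).cycleRange⁻¹ (f k.succ)) hρ
    simp [Equiv.Perm.inv_def] at h1
    simp [h1]
  rw [hcomp, sumCochains_perm I hi ρ, hsign, smul_smul, smul_smul]
  congr 1
  have : (-1 : ℤ) ^ (p : ℕ) * (-1 : ℤ) ^ (p : ℕ) = 1 := by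
    rw [← mul_pow]; simp
  linear_combination ((-1 : ℤ) ^ ((τ p : Fin (q + 2)) : ℕ) * (Equiv.Perm.sign τ : ℤ)) * this

theorem sumCoboundaryAux_mem {q : ℕ} {i : (Fin (q + 1) → Fin (n + 1)) → A}
    (hi : i ∈ sumCochains I q) : sumCoboundaryAux R A n q i ∈ sumCochains I (q + 1) := by
  refine ⟨fun α => ?_, fun α j k hjk => ?_, fun α j k hjk hα => ?_⟩
  · rw [sumCoboundaryAux_apply]
    refine Submodule.sum_mem _ fun p _ => ?_
    refine zsmul_mem ?_ _
    exact (iSup_le fun k => le_iSup (fun k => I (α k)) (p.succAbove k)) (hi.1 (α ∘ p.succAbove))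
  · simp only [sumCoboundaryAux_apply, sumCoboundary_term_perm I hi (Equiv.swap j k) α, Equiv.Perm.sign_swap hjk]
    rw [← Finset.smul_sum, Equiv.sum_comp (Equiv.swap j k)
      (fun p => (-1 : ℤ) ^ (p : ℕ) • i (α ∘ p.succAbove))]
    simp
  · rw [sumCoboundaryAux_apply]
    have hswap : α ∘ Equiv.swap j k = α := by
      funext x
      by_cases hxj : x = j
      · subst hxj; simp [hα]
      · by_cases hxk : x = k
        · subst hxk; simp [hα]
        · simp [Equiv.swap_apply_of_ne_of_ne hxj hxk]
    refine Finset.sum_involution (fun p _ => Equiv.swap j k p) (fun p _ => ?_) (fun p _ hp => ?_)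
      (fun _ _ => Finset.mem_univ _) (fun p _ => by simp)
    · have := sumCoboundary_term_perm I hi (Equiv.swap j k) α p
      rw [hswap, Equiv.Perm.sign_swap hjk] at this
      rw [this]
      simp
    · intro hfix
      apply hp
      have hpj : j ≠ p := by
        rintro rfl
        exact hjk (by simpa using hfix.symm)
      have hpk : k ≠ p := by
        rintro rfl
        exact hjk (by simpa using hfix)
      obtain ⟨j', rfl⟩ := Fin.exists_succAbove_eq hpj
      obtain ⟨k', rfl⟩ := Fin.exists_succAbove_eq hpk
      rw [hi.2.2 (α ∘ p.succAbove) j' k' (fun h => hjk (by rw [h])) hα, smul_zero]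

theorem sumCoboundaryAux_comp (q : ℕ) (i : (Fin (q + 1) → Fin (n + 1)) → A) :
    sumCoboundaryAux R A n (q + 1) (sumCoboundaryAux R A n q i) = 0 := by
  funext α
  change (∑ p : Fin (q + 3), (-1 : ℤ) ^ (p : ℕ) •
    ∑ r : Fin (q + 2), (-1 : ℤ) ^ (r : ℕ) • i ((α ∘ p.succAbove) ∘ r.succAbove)) = 0
  simp only [Finset.smul_sum, smul_smul, ← pow_add]
  rw [← Finset.sum_product', Finset.univ_product_univ]
  refine Finset.sum_involution (fun x _ => (x.1.succAbove x.2, x.2.predAbove x.1))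
    (fun x _ => ?_) (fun x _ _ h => ?_) (fun _ _ => Finset.mem_univ _) (fun x _ => ?_)
  · have h : (α ∘ (x.1.succAbove x.2).succAbove) ∘ (x.2.predAbove x.1).succAbove =
        (α ∘ x.1.succAbove) ∘ x.2.succAbove := by
      funext k
      simp [Fin.succAbove_succAbove_succAbove_predAbove]
    simp only [h, Fin.neg_one_pow_succAbove_add_predAbove]
    simp
  · exact Fin.succAbove_ne _ _ (congrArg Prod.fst h)
  · ext1 <;> simp [Fin.succAbove_succAbove_predAbove, Fin.predAbove_predAbove_succAbove]

/-- The coboundary operator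
`(d i) α = ∑ p, (-1) ^ p * i (α with its p-th index removed)`. -/
def sumCoboundary (q : ℕ) : sumCochains I q →ₗ[R] sumCochains I (q + 1) :=
  (sumCoboundaryAux R A n q).restrict fun _ hi => sumCoboundaryAux_mem I hi

/-- The cochain complex of left `R`-modules with terms `sumCochains I q`, `q ≥ 0`. -/
noncomputable def sumComplex : CochainComplex (ModuleCat.{v} R) ℕ :=
  CochainComplex.of (fun q => ModuleCat.of R (sumCochains I q))
    (fun q => ModuleCat.ofHom (sumCoboundary I q))
    (fun q => by
      ext i
      exact congrFun (sumCoboundaryAux_comp (R := R) q i.1) _)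

end Cochains

/-- For a cochain complex `K` of left `R`-modules, the contravariant functor
`M ↦ Hom_R(M, K)` to cochain complexes of abelian groups. -/
noncomputable def homComplexFunctor {R : Type u} [Ring R] (K : CochainComplex (ModuleCat.{v} R) ℕ) :
    (ModuleCat.{v} R)ᵒᵖ ⥤ CochainComplex AddCommGrpCat.{v} ℕ where
  obj M := ((preadditiveCoyoneda.obj M).mapHomologicalComplex _).obj K
  map f := (NatTrans.mapHomologicalComplex (preadditiveCoyoneda.map f) _).app K

/-- For a cochain complex `K` of left `R`-modules, the contravariant functor
`M ↦ H^q(Hom_R(M, K))` to abelian groups. -/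
noncomputable def homCohomology {R : Type u} [Ring R] (K : CochainComplex (ModuleCat.{v} R) ℕ)
    (q : ℕ) : (ModuleCat.{v} R)ᵒᵖ ⥤ AddCommGrpCat.{v} :=
  homComplexFunctor K ⋙ HomologicalComplex.homologyFunctor AddCommGrpCat.{v} (ComplexShape.up ℕ) q

/-! ### Alternating cochains and strictly increasing index sequences -/

section Cochains

variable {R : Type u} [Ring R] {A : Type v} [AddCommGroup A] [Module R A]
  {n : ℕ}

/-! The complex of sums, augmented by constant cochains, is an injective resolution of the
intersection (`sumResolution`); its `Hom` cohomology is therefore `Ext` (`extIsoHomCohomology`).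

Exactness (`exists_sumCoboundaryAux_eq`) is an induction on the number of submodules. A cochain
splits into its entries avoiding the index 0 and those containing it, which displays the complex as
a mapping cone of the complexes of `I (k+1)` and of `I 0 ⊔ I (k+1)`. Distributivity enters only at
the bottom, as `⨅ (I 0 ⊔ I (k+1)) ≤ I 0 ⊔ ⨅ I (k+1)`, a Chinese remainder argument.

Injectivity of the terms: over a hereditary ring finite sums of injective submodules are injective
(`IsLeftHereditary.baer_iSup`), and a term is a product of such sums over increasing sequences.

For the vanishing over a Dedekind domain, non-singular means torsion-free, so division is unique,
the intersection is again divisible, hence injective, and its higher `Ext` is zero. -/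

theorem sumCochains_ext {I : Fin (n + 1) → Submodule R A} {q : ℕ}
    {i j : (Fin (q + 1) → Fin (n + 1)) → A}
    (hi : i ∈ sumCochains I q) (hj : j ∈ sumCochains I q)
    (h : ∀ α, StrictMono α → i α = j α) : i = j := by
  funext α
  by_cases hα : Function.Injective α
  · have hs : StrictMono (α ∘ Tuple.sort α) :=
      (Tuple.monotone_sort α).strictMono_of_injective (hα.comp (Tuple.sort α).injective)
    have := h _ hs
    rw [sumCochains_perm I hi, sumCochains_perm I hj] at this
    have h2 := congrArg (fun x => (Equiv.Perm.sign (Tuple.sort α) : ℤ) • x) this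
    simpa [smul_smul, ← Units.val_mul] using h2
  · simp only [Function.Injective, not_forall] at hα
    obtain ⟨a, b, hab, hne⟩ := hα
    rw [hi.2.2 α a b hne hab, hj.2.2 α a b hne hab]

/-- Sort the indices and multiply by the sign; use 0 when an index repeats. With `sumCochains_ext`,
cochains become a product over increasing sequences. -/
theorem exists_sumCochains_eq_on_strictMono (I : Fin (n + 1) → Submodule R A) {q : ℕ}
    (g : (Fin (q + 1) → Fin (n + 1)) → A) (hg : ∀ α, StrictMono α → g α ∈ ⨆ k, I (α k)) :
    ∃ i ∈ sumCochains I q, ∀ α, StrictMono α → i α = g α := by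
  classical
  refine ⟨fun α => if Function.Injective α then
    (Equiv.Perm.sign (Tuple.sort α) : ℤ) • g (α ∘ Tuple.sort α) else 0,
    ⟨fun α => ?_, fun α j k hjk => ?_, fun α j k hjk h => ?_⟩, fun α hα => ?_⟩
  · dsimp only
    split_ifs with h
    · refine zsmul_mem ?_ _
      have := hg _ ((Tuple.monotone_sort α).strictMono_of_injective
        (h.comp (Tuple.sort α).injective))
      exact (iSup_le fun k => le_iSup (fun k => I (α k)) (Tuple.sort α k)) this
    · exact zero_mem _
  · dsimp only
    by_cases h : Function.Injective α
    · have h' : Function.Injective (α ∘ Equiv.swap j k) := h.comp (Equiv.injective _)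
      rw [if_pos h, if_pos h', Tuple.comp_perm_comp_sort_eq_comp_sort]
      have hc := Tuple.comp_perm_comp_sort_eq_comp_sort (f := α) (σ := Equiv.swap j k)
      -- An injective sequence is sorted by only one permutation, so the two sorting permutations
      -- differ by a transposition and have opposite signs.
      have hs : Equiv.swap j k * Tuple.sort (α ∘ Equiv.swap j k) = Tuple.sort α := by
        ext x : 1
        exact h (congrFun hc x)
      rw [← hs, Equiv.Perm.sign_mul, Equiv.Perm.sign_swap hjk]
      simp
    · have h' : ¬ Function.Injective (α ∘ Equiv.swap j k) := by
        intro h'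
        apply h
        have := h'.comp (Equiv.swap j k).injective
        rwa [Function.comp_assoc, ← Equiv.coe_trans, Equiv.swap_swap, Equiv.coe_refl,
          Function.comp_id] at this
      rw [if_neg h, if_neg h', add_zero]
  · exact if_neg fun hinj => hjk (hinj h)
  · dsimp only
    rw [if_pos hα.injective, Tuple.sort_eq_refl_iff_monotone.2 hα.monotone]
    simp

/-! ### Splitting off the index 0 -/

theorem strictMono_fin_succ_cases {q : ℕ} {α : Fin (q + 1) → Fin (n + 2)} (hα : StrictMono α) :
    (∃ β : Fin (q + 1) → Fin (n + 1), StrictMono β ∧ α = Fin.succ ∘ β) ∨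
    ∃ γ : Fin q → Fin (n + 1), StrictMono γ ∧ α = Fin.cons 0 (Fin.succ ∘ γ) := by
  have key : ∀ {m : ℕ} (δ : Fin m → Fin (n + 2)), StrictMono δ → (∀ x, δ x ≠ 0) →
      ∃ β : Fin m → Fin (n + 1), StrictMono β ∧ δ = Fin.succ ∘ β := fun δ hδ h =>
    ⟨fun x => (δ x).pred (h x), fun x y hxy => by simpa using hδ hxy, by funext x; simp⟩
  by_cases h0 : α 0 = 0
  · right
    obtain ⟨γ, hγ, h⟩ := key (Fin.tail α) (hα.comp (Fin.strictMono_succ))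
      (fun x hx => by
        have := hα (Fin.succ_pos x)
        rw [h0, show α x.succ = 0 from hx] at this
        exact lt_irrefl _ this)
    refine ⟨γ, hγ, ?_⟩
    rw [← h, ← h0, Fin.cons_self_tail]
  · left
    refine key α hα fun x hx => h0 ?_
    have := hα.monotone (Fin.zero_le x)
    rw [hx] at this
    exact Fin.le_zero_iff.1 this

theorem strictMono_cons_zero {q : ℕ} {γ : Fin q → Fin (n + 1)} (hγ : StrictMono γ) :
    StrictMono (Fin.cons 0 (Fin.succ ∘ γ) : Fin (q + 1) → Fin (n + 2)) := by
  intro x y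
  induction x using Fin.cases <;> induction y using Fin.cases <;> intro h
  · exact absurd h (lt_irrefl _)
  · simp
  · exact absurd h (by simp)
  · simpa using hγ (by simpa using h)

theorem cons_zero_comp_succAbove_succ {q : ℕ} (γ : Fin (q + 1) → Fin (n + 1)) (p : Fin (q + 1)) :
    (Fin.cons 0 (Fin.succ ∘ γ) : Fin (q + 2) → Fin (n + 2)) ∘ p.succ.succAbove =
      Fin.cons 0 (Fin.succ ∘ (γ ∘ p.succAbove)) := by
  funext x
  induction x using Fin.cases <;> simp

theorem cons_zero_comp_succAbove_zero {q : ℕ} (γ : Fin (q + 1) → Fin (n + 1)) :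
    (Fin.cons 0 (Fin.succ ∘ γ) : Fin (q + 2) → Fin (n + 2)) ∘ (0 : Fin (q + 2)).succAbove =
      Fin.succ ∘ γ := by
  funext x
  simp

/-- The mapping cone formula. The sum stays explicit because for `q = 0` it runs over empty
sequences, where no cochain module is defined. -/
theorem sumCoboundaryAux_cons_zero {q : ℕ} (i : (Fin (q + 1) → Fin (n + 2)) → A)
    (γ : Fin (q + 1) → Fin (n + 1)) :
    sumCoboundaryAux R A (n + 1) q i (Fin.cons 0 (Fin.succ ∘ γ)) =
      i (Fin.succ ∘ γ) - ∑ p : Fin (q + 1), (-1 : ℤ) ^ (p : ℕ) •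
        i (Fin.cons 0 (Fin.succ ∘ (γ ∘ p.succAbove))) := by
  rw [sumCoboundaryAux_apply, Fin.sum_univ_succ, cons_zero_comp_succAbove_zero]
  simp only [cons_zero_comp_succAbove_succ, Fin.val_zero, pow_zero, one_smul, Fin.val_succ, pow_succ,
    mul_neg, mul_one, neg_smul, Finset.sum_neg_distrib, sub_eq_add_neg]

theorem sumCochains_comp_succ {I : Fin (n + 2) → Submodule R A} {q : ℕ}
    {i : (Fin (q + 1) → Fin (n + 2)) → A} (hi : i ∈ sumCochains I q) :
    (fun β : Fin (q + 1) → Fin (n + 1) => i (Fin.succ ∘ β)) ∈ sumCochains (I ∘ Fin.succ) q :=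
  ⟨fun β => hi.1 (Fin.succ ∘ β), fun β j k h => hi.2.1 (Fin.succ ∘ β) j k h,
    fun β j k h e => hi.2.2 (Fin.succ ∘ β) j k h (congrArg Fin.succ e)⟩

theorem iSup_cons_zero (I : Fin (n + 2) → Submodule R A) {q : ℕ} (γ : Fin q → Fin (n + 1)) :
    ⨆ k, I ((Fin.cons 0 (Fin.succ ∘ γ) : Fin (q + 1) → Fin (n + 2)) k) =
      I 0 ⊔ ⨆ k, I (γ k).succ := by
  apply le_antisymm
  · refine iSup_le fun k => ?_
    induction k using Fin.cases with
    | zero => exact le_sup_left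
    | succ k => exact (le_iSup (fun k => I (γ k).succ) k).trans le_sup_right
  · refine sup_le (le_iSup (fun k => I ((Fin.cons 0 (Fin.succ ∘ γ) :
      Fin (q + 1) → Fin (n + 2)) k)) 0) (iSup_le fun k => ?_)
    exact le_iSup (fun k => I ((Fin.cons 0 (Fin.succ ∘ γ) : Fin (q + 1) → Fin (n + 2)) k)) k.succ

/-- Moving `I 0` inside the supremum needs at least one remaining index, hence the degree `q + 1`.
-/
theorem sumCochains_comp_cons_zero {I : Fin (n + 2) → Submodule R A} {q : ℕ}
    {i : (Fin (q + 2) → Fin (n + 2)) → A} (hi : i ∈ sumCochains I (q + 1)) :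
    (fun γ : Fin (q + 1) → Fin (n + 1) => i (Fin.cons 0 (Fin.succ ∘ γ))) ∈
      sumCochains (fun k => I 0 ⊔ I k.succ) q := by
  refine ⟨fun γ => ?_, fun γ j k h => ?_, fun γ j k h e => ?_⟩
  · have := hi.1 (Fin.cons 0 (Fin.succ ∘ γ))
    rw [iSup_cons_zero] at this
    rwa [← sup_iSup]
  · have := hi.2.1 (Fin.cons 0 (Fin.succ ∘ γ)) j.succ k.succ (by simpa using h)
    convert this using 3
    funext x
    induction x using Fin.cases with
    | zero => simp [Equiv.swap_apply_of_ne_of_ne (Fin.succ_ne_zero j).symm (Fin.succ_ne_zero k).symm]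
    | succ x => simp [(Fin.succ_injective (q + 1)).swap_apply]
  · exact hi.2.2 (Fin.cons 0 (Fin.succ ∘ γ)) j.succ k.succ (by simpa using h) (by simpa using e)

theorem sumCochains_mono {I J : Fin (n + 1) → Submodule R A} (h : ∀ k, I k ≤ J k) {q : ℕ} :
    sumCochains I q ≤ sumCochains J q :=
  fun _ hi => ⟨fun α => iSup_mono (fun k => h (α k)) (hi.1 α), hi.2⟩

/-- The two components of a cochain can be prescribed independently. `L` need not be alternating, as
only its values on increasing sequences matter; this also covers empty sequences. -/
theorem exists_sumCochains_glue (I : Fin (n + 2) → Submodule R A) {q : ℕ}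
    {J : (Fin (q + 1) → Fin (n + 1)) → A} (hJ : J ∈ sumCochains (I ∘ Fin.succ) q)
    {L : (Fin q → Fin (n + 1)) → A} (hL : ∀ γ, L γ ∈ I 0 ⊔ ⨆ k, I (γ k).succ) :
    ∃ j ∈ sumCochains I q, (∀ β, StrictMono β → j (Fin.succ ∘ β) = J β) ∧
      ∀ γ, StrictMono γ → j (Fin.cons 0 (Fin.succ ∘ γ)) = L γ := by
  have hpred : ∀ {m : ℕ} (β : Fin m → Fin (n + 1)),
      Fin.predAbove (0 : Fin (n + 1)) ∘ (Fin.succ ∘ β) = β := fun β => by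
    funext x
    simp
  obtain ⟨j, hj, h⟩ := exists_sumCochains_eq_on_strictMono I (fun α : Fin (q + 1) → Fin (n + 2) =>
    if α 0 = 0 then L (Fin.predAbove (0 : Fin (n + 1)) ∘ Fin.tail α)
    else J (Fin.predAbove (0 : Fin (n + 1)) ∘ α)) (fun α hα => by
      rcases strictMono_fin_succ_cases hα with ⟨β, hβ, rfl⟩ | ⟨γ, hγ, rfl⟩
      · rw [if_neg (by simp), hpred]
        exact hJ.1 β
      · rw [if_pos (by simp), Fin.tail_cons, hpred, iSup_cons_zero]
        exact hL γ)
  refine ⟨j, hj, fun β hβ => ?_, fun γ hγ => ?_⟩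
  · rw [h _ (Fin.strictMono_succ.comp hβ), if_neg (by simp), hpred]
  · rw [h _ (strictMono_cons_zero hγ), if_pos (by simp), Fin.tail_cons, hpred]

theorem sumCochains_zero_cocycle {I : Fin (n + 1) → Submodule R A}
    {i : (Fin 1 → Fin (n + 1)) → A} (hi : i ∈ sumCochains I 0)
    (hd : sumCoboundaryAux R A n 0 i = 0) : ∃ c ∈ ⨅ k, I k, ∀ α, i α = c := by
  have hc : ∀ α, i α = i (fun _ => 0) := fun α => by
    have := congrFun hd ![0, α 0]
    rw [sumCoboundaryAux_apply, Fin.sum_univ_two, Pi.zero_apply] at this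
    have e0 : (![0, α 0] : Fin 2 → Fin (n + 1)) ∘ (0 : Fin 2).succAbove = α := by
      funext x
      rw [Subsingleton.elim x 0]
      rfl
    have e1 : (![0, α 0] : Fin 2 → Fin (n + 1)) ∘ (1 : Fin 2).succAbove = fun _ => 0 := by
      funext x
      rw [Subsingleton.elim x 0]
      rfl
    rw [e0, e1] at this
    simpa [add_neg_eq_zero] using this
  refine ⟨i (fun _ => 0), ?_, hc⟩
  rw [Submodule.mem_iInf]
  intro k
  have := hi.1 (fun _ => k)
  rw [hc (fun _ => k)] at this
  simpa using this

/-! ### Exactness from distributivity -/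

theorem IsDistributiveModule.iInf_sup_le (hA : IsDistributiveModule R A) (J : Submodule R A)
    (I : Fin (n + 1) → Submodule R A) : ⨅ k, (J ⊔ I k) ≤ J ⊔ ⨅ k, I k := by
  let _ : DistribLattice (Submodule R A) := DistribLattice.ofInfSupLe fun X Y Z => (hA X Y Z).le
  have h : ∀ s : Finset (Fin (n + 1)), ⨅ k ∈ s, (J ⊔ I k) ≤ J ⊔ ⨅ k ∈ s, I k := fun s => by
    induction s using Finset.induction_on with
    | empty => simp
    | insert a s _ ih =>
      rw [Finset.iInf_insert, Finset.iInf_insert]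
      exact (inf_le_inf_left _ ih).trans (sup_inf_left _ _ _).ge
  simpa using h Finset.univ

/-- In components `(i', k)`, closedness says `d i' = 0` and `d k = i'`, and a primitive `(J, L)`
must satisfy `d J = i'` and `J - d L = k`. The induction quantifies over `I` because it is applied
to two different families. -/
theorem exists_sumCoboundaryAux_eq (hA : IsDistributiveModule R A) (n : ℕ) :
    ∀ (I : Fin (n + 1) → Submodule R A) (q : ℕ) (i : (Fin (q + 2) → Fin (n + 1)) → A),
      i ∈ sumCochains I (q + 1) → sumCoboundaryAux R A n (q + 1) i = 0 →
      ∃ j ∈ sumCochains I q, sumCoboundaryAux R A n q j = i := by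
  induction n with
  | zero =>
    intro I q i hi _
    refine ⟨0, zero_mem _, ?_⟩
    rw [map_zero]
    funext α
    exact (hi.2.2 α 0 1 (by simp) (Subsingleton.elim (α := Fin 1) _ _)).symm
  | succ n ih =>
    intro I q i hi hd
    have hi' := sumCochains_comp_succ hi
    have hk := sumCochains_comp_cons_zero hi
    set i' := fun β : Fin (q + 2) → Fin (n + 1) => i (Fin.succ ∘ β) with hi'_def
    set k := fun γ : Fin (q + 1) → Fin (n + 1) => i (Fin.cons 0 (Fin.succ ∘ γ)) with hk_def
    have hdi' : sumCoboundaryAux R A n (q + 1) i' = 0 := by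
      funext β
      exact congrFun hd (Fin.succ ∘ β)
    have hdk : sumCoboundaryAux R A n q k = i' := by
      funext β
      have := congrFun hd (Fin.cons 0 (Fin.succ ∘ β))
      rw [sumCoboundaryAux_cons_zero] at this
      exact (sub_eq_zero.1 this).symm
    obtain ⟨J, hJ, hdJ⟩ := ih _ _ i' hi' hdi'
    have hJk : J - k ∈ sumCochains (fun k => I 0 ⊔ I k.succ) q :=
      sub_mem (sumCochains_mono (fun _ => le_sup_right) hJ) hk
    have hdJk : sumCoboundaryAux R A n q (J - k) = 0 := by
      rw [map_sub, hdJ, hdk, sub_self]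
    -- `J - k` is closed for the family `I 0 ⊔ I (k+1)`. In positive degree the induction hypothesis
    -- gives `L`; in degree 0 `J` must be corrected as well.
    have key : ∃ (J : (Fin (q + 1) → Fin (n + 1)) → A) (L : (Fin q → Fin (n + 1)) → A),
        J ∈ sumCochains (I ∘ Fin.succ) q ∧ (∀ γ, L γ ∈ I 0 ⊔ ⨆ k, I (γ k).succ) ∧
        sumCoboundaryAux R A n q J = i' ∧
        ∀ γ, ∑ p : Fin (q + 1), (-1 : ℤ) ^ (p : ℕ) • L (γ ∘ p.succAbove) = J γ - k γ := by
      cases q with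
      | zero =>
        obtain ⟨c, hc, hcc⟩ := sumCochains_zero_cocycle hJk hdJk
        -- `J - k` is a constant `c`. Distributivity writes `c = b + a` with `b` in `I 0` and `a` in
        -- all the other submodules; subtracting `a` from `J` keeps `d J`, and `b` serves as `L`.
        obtain ⟨b, hb, a, ha, hab⟩ := Submodule.mem_sup.1
          (hA.iInf_sup_le (I 0) (fun k => I k.succ) hc)
        refine ⟨J - fun _ => a, fun _ => b, sub_mem hJ ⟨fun α => ?_, fun _ j k h => ?_,
          fun _ j k h => ?_⟩, fun γ => Submodule.mem_sup_left hb, ?_, fun γ => ?_⟩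
        · exact Submodule.mem_iSup_of_mem 0 ((Submodule.mem_iInf _).1 ha (α 0))
        · exact absurd (Subsingleton.elim (α := Fin 1) _ _) h
        · exact absurd (Subsingleton.elim (α := Fin 1) _ _) h
        · rw [map_sub, hdJ, sub_eq_self]
          funext α
          simp [sumCoboundaryAux_apply, Fin.sum_univ_two]
        · rw [Pi.sub_apply, sub_right_comm, ← Pi.sub_apply, hcc γ, ← hab]
          simp
      | succ q =>
        obtain ⟨L, hL, hdL⟩ := ih _ _ (J - k) hJk hdJk
        refine ⟨J, L, hJ, fun γ => ?_, hdJ, fun γ => congrFun hdL γ⟩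
        have := hL.1 γ
        rwa [← sup_iSup] at this
    obtain ⟨J, L, hJ, hL, hdJ, hdL⟩ := key
    obtain ⟨j, hj, hjJ, hjL⟩ := exists_sumCochains_glue I hJ hL
    refine ⟨j, hj, sumCochains_ext (sumCoboundaryAux_mem I hj) hi fun α hα => ?_⟩
    rcases strictMono_fin_succ_cases hα with ⟨β, hβ, rfl⟩ | ⟨γ, hγ, rfl⟩
    · rw [← show i' β = i (Fin.succ ∘ β) from rfl, ← hdJ, sumCoboundaryAux_apply,
        sumCoboundaryAux_apply]
      refine Finset.sum_congr rfl fun p _ => ?_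
      rw [Function.comp_assoc, hjJ _ (hβ.comp (Fin.strictMono_succAbove p))]
    · rw [sumCoboundaryAux_cons_zero, hjJ γ hγ, ← show k γ = i (Fin.cons 0 (Fin.succ ∘ γ)) from rfl,
        ← sub_sub_cancel (J γ) (k γ), ← hdL]
      congr 1
      refine Finset.sum_congr rfl fun p _ => ?_
      rw [hjL _ (hγ.comp (Fin.strictMono_succAbove p))]

end Cochains

/-! ### Injectivity of the cochain modules -/

section Injectivity

variable {R : Type u} [Ring R] {A : Type v} [AddCommGroup A] [Module R A]
  {n : ℕ}

/-- The finite product of the `I k` maps onto their sum. As `J` is projective, `g` lifts to the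
product, where it extends coordinatewise. -/
theorem IsLeftHereditary.baer_iSup (hR : IsLeftHereditary R) {ι : Type*} [Fintype ι]
    (I : ι → Submodule R A) (hI : ∀ k, Module.Baer R (I k)) :
    Module.Baer R ↥(⨆ k, I k) := by
  classical
  intro J g
  let s : ((k : ι) → I k) →ₗ[R] ↥(⨆ k, I k) :=
    ∑ k, (Submodule.inclusion (le_iSup I k)) ∘ₗ LinearMap.proj k
  have hsapp : ∀ x, ((s x : ↥(⨆ k, I k)) : A) = ∑ k, (x k : A) := fun x => by
    simp [s]
  have hs : Function.Surjective s := by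
    rintro ⟨x, hx⟩
    obtain ⟨f, hf⟩ := (Submodule.mem_iSup_iff_exists_finsupp I x).1 hx
    refine ⟨fun k => ⟨f k, hf.1 k⟩, Subtype.ext ?_⟩
    rw [hsapp]
    exact (Finsupp.sum_fintype f (fun _ y => y) (fun _ => rfl)).symm.trans hf.2
  have := hR J
  obtain ⟨l, hl⟩ := Module.projective_lifting_property s g hs
  choose e he using fun k => hI k J (LinearMap.proj k ∘ₗ l)
  refine ⟨s ∘ₗ LinearMap.pi e, fun x hx => ?_⟩
  rw [← hl]
  simp only [LinearMap.comp_apply]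
  congr 1
  funext k
  exact he k x hx

theorem baer_sumCochains {I : Fin (n + 1) → Submodule R A} {q : ℕ}
    (hI : ∀ α : Fin (q + 1) → Fin (n + 1), Module.Baer R ↥(⨆ k, I (α k))) :
    Module.Baer R (sumCochains I q) := by
  intro J g
  -- An extension to `R` is multiplication by its value at 1. These values are chosen independently
  -- for each sequence; only those at increasing ones are glued into a cochain.
  have hev : ∀ α : Fin (q + 1) → Fin (n + 1), ∃ y : ↥(⨆ k, I (α k)),
      ∀ (x : R) (hx : x ∈ J), x • (y : A) = (g ⟨x, hx⟩ : (Fin (q + 1) → Fin (n + 1)) → A) α := by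
    intro α
    obtain ⟨e, he⟩ := hI α J
      (((LinearMap.proj α ∘ₗ (sumCochains I q).subtype).codRestrict _ fun i => i.2.1 α) ∘ₗ g)
    refine ⟨e 1, fun x hx => ?_⟩
    rw [← Submodule.coe_smul, ← map_smul, smul_eq_mul, mul_one, he x hx]
    rfl
  choose y hy using hev
  obtain ⟨i, hi, h⟩ := exists_sumCochains_eq_on_strictMono I (fun α => (y α : A))
    fun α _ => (y α).2
  refine ⟨LinearMap.toSpanSingleton R _ ⟨i, hi⟩, fun x hx => Subtype.ext ?_⟩
  refine sumCochains_ext (Subtype.prop _) (Subtype.prop _) fun α hα => ?_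
  rw [← hy α x hx, ← h α hα]
  rfl

theorem IsLeftHereditary.injective_sumCochains [Small.{v} R] (hR : IsLeftHereditary R)
    (I : Fin (n + 1) → Submodule R A) (hI : ∀ k, Module.Injective R (I k)) (q : ℕ) :
    Module.Injective R (sumCochains I q) :=
  (baer_sumCochains fun α => hR.baer_iSup (fun k => I (α k))
    fun k => Module.Baer.of_injective (hI (α k))).injective

end Injectivity

theorem IsDedekindDomain.isLeftHereditary (R : Type u) [CommRing R] [IsDedekindDomain R] :
    IsLeftHereditary R := by
  intro J
  have : Module.FinitePresentation R J := Module.finitePresentation_of_finite R J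
  exact Module.Flat.projective_of_finitePresentation

/-! ### Non-singular modules over a domain -/

section Domain

variable {R : Type u} [CommRing R] {A : Type v} [AddCommGroup A] [Module R A]

/-- In a domain every nonzero principal ideal is essential. -/
theorem IsNonsingularModule.eq_zero_of_smul_eq_zero [IsDomain R] (hA : IsNonsingularModule R A) {r : R}
    (hr : r ≠ 0) {a : A} (h : r • a = 0) : a = 0 := by
  refine hA a ⟨Ideal.span {r}, fun J hJ hbot => ?_, fun s hs => ?_⟩
  · obtain ⟨x, hx, hx0⟩ := J.ne_bot_iff.1 hJ
    have : r * x ∈ Ideal.span {r} ⊓ J :=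
      ⟨Ideal.mul_mem_right _ _ (Ideal.mem_span_singleton_self r), J.mul_mem_left _ hx⟩
    rw [hbot] at this
    exact mul_ne_zero hr hx0 this
  · obtain ⟨c, rfl⟩ := Ideal.mem_span_singleton'.1 hs
    rw [mul_smul, h, smul_zero]

theorem Module.Baer.exists_smul_eq [IsDomain R] {Q : Type v} [AddCommGroup Q] [Module R Q]
    (hQ : Module.Baer R Q) {r : R} (hr : r ≠ 0) (x : Q) : ∃ y : Q, r • y = x := by
  let e : R ≃ₗ[R] Ideal.span {r} := LinearEquiv.toSpanNonzeroSingleton R R r hr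
  obtain ⟨f, hf⟩ := hQ (Ideal.span {r}) (LinearMap.toSpanSingleton R Q x ∘ₗ e.symm.toLinearMap)
  refine ⟨f 1, ?_⟩
  rw [← map_smul, smul_eq_mul, mul_one, hf r (Ideal.mem_span_singleton_self r)]
  have : e.symm ⟨r, Ideal.mem_span_singleton_self r⟩ = 1 := by
    rw [LinearEquiv.symm_apply_eq]
    ext
    simp [e]
  simp [this]

/-- One nonzero `r` in `J` suffices: if `r • y = g r`, then `r • (z • y - g z) = 0` for all `z` in
`J`. -/
theorem Module.Baer.of_exists_smul_eq {Q : Type v} [AddCommGroup Q] [Module R Q]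
    (htf : ∀ (r : R) (x : Q), r ≠ 0 → r • x = 0 → x = 0)
    (hdiv : ∀ (r : R) (x : Q), r ≠ 0 → ∃ y : Q, r • y = x) : Module.Baer R Q := by
  intro J g
  by_cases hJ : J = ⊥
  · subst hJ
    refine ⟨0, fun x hx => ?_⟩
    have : (⟨x, hx⟩ : (⊥ : Ideal R)) = 0 := Subsingleton.elim _ _
    rw [this, map_zero, LinearMap.zero_apply]
  · obtain ⟨r, hrJ, hr⟩ := J.ne_bot_iff.1 hJ
    obtain ⟨y, hy⟩ := hdiv r (g ⟨r, hrJ⟩) hr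
    refine ⟨LinearMap.toSpanSingleton R Q y, fun z hz => sub_eq_zero.1 (htf r _ hr ?_)⟩
    rw [LinearMap.toSpanSingleton_apply, smul_sub, smul_comm, hy, ← map_smul, ← map_smul, sub_eq_zero]
    congr 1
    ext
    exact mul_comm _ _

theorem IsNonsingularModule.injective_iInf [IsDomain R] [Small.{v} R] (hA : IsNonsingularModule R A)
    {ι : Type*} [Nonempty ι] (I : ι → Submodule R A) (hI : ∀ k, Module.Injective R (I k)) :
    Module.Injective R ↥(⨅ k, I k) := by
  refine (Module.Baer.of_exists_smul_eq (fun r x hr h => ?_) fun r x hr => ?_).injective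
  · exact Subtype.ext (hA.eq_zero_of_smul_eq_zero hr (congrArg Subtype.val h))
  · have hx := (Submodule.mem_iInf _).1 x.2
    choose y hy using fun k =>
      (Module.Baer.of_injective (hI k)).exists_smul_eq hr (⟨x, hx k⟩ : I k)
    replace hy : ∀ k, r • (y k : A) = x := fun k => congrArg Subtype.val (hy k)
    let k₀ := Classical.arbitrary ι
    refine ⟨⟨y k₀, (Submodule.mem_iInf _).2 fun k => ?_⟩, Subtype.ext (hy k₀)⟩
    -- Torsion-freeness makes the quotient of `x` by `r` unique in `A`, so the quotients found in
    -- the various `I k` coincide.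
    have : (y k₀ : A) = y k := sub_eq_zero.1
      (hA.eq_zero_of_smul_eq_zero hr (by rw [smul_sub, hy, hy, sub_self]))
    rw [this]
    exact (y k).2

end Domain

/-! ### `Ext` as the cohomology of an injective resolution -/

section ExtCohomology

open CategoryTheory.Limits Abelian

universe w v' u'

variable {C : Type u'} [Category.{v'} C] [Abelian C] [HasExt.{w} C]

/-- There are no coboundaries in degree 0, as the resolution extended to integer degrees vanishes in
degree -1. -/
theorem CategoryTheory.InjectiveResolution.extMk_zero_eq_zero_iff {X Y : C}
    (P : InjectiveResolution Y) (f : X ⟶ P.cocomplex.X 0) (hf : f ≫ P.cocomplex.d 0 1 = 0) :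
    P.extMk f 1 rfl hf = 0 ↔ f = 0 := by
  refine ⟨fun h => ?_, fun h => by subst h; exact P.extMk_zero 1 rfl⟩
  simp only [← P.extEquivCohomologyClass.apply_eq_iff_eq,
    InjectiveResolution.extEquivCohomologyClass_extMk,
    InjectiveResolution.extEquivCohomologyClass_zero,
    CochainComplex.HomComplex.CohomologyClass.mk_eq_zero_iff] at h
  rw [CochainComplex.HomComplex.Cocycle.fromSingleMk_mem_coboundaries_iff _ _ _ _ _ (-1)
    (by lia)] at h
  obtain ⟨g, hg⟩ := h
  have hz : IsZero (P.cochainComplex.X (-1)) :=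
    P.cochainComplex.isZero_of_isStrictlyGE 0 (-1) (by lia)
  rw [hz.eq_of_tgt g 0, zero_comp] at hg
  rw [← cancel_mono (P.cochainComplexXIso 0 0 rfl).inv, zero_comp]
  exact hg.symm

end ExtCohomology

section Ab

variable (K : CochainComplex AddCommGrpCat.{v} ℕ)

theorem exists_iCycles_eq {q : ℕ} (x : K.X q) (hx : K.d q (q + 1) x = 0) :
    ∃ z : K.cycles q, K.iCycles q z = x := by
  have hn : (ComplexShape.up ℕ).next q = q + 1 := CochainComplex.next ℕ q
  have hx' : (K.sc q).g x = 0 := by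
    change K.d q ((ComplexShape.up ℕ).next q) x = 0
    rw [hn]
    exact hx
  exact ⟨(K.sc q).abCyclesIso.inv ⟨x, hx'⟩, (K.sc q).abCyclesIso_inv_apply_iCycles ⟨x, hx'⟩⟩

theorem homologyπ_surjective (q : ℕ) : Function.Surjective (K.homologyπ q) :=
  (AddCommGrpCat.epi_iff_surjective _).1 inferInstance

end Ab

section Resolution

variable {R : Type u} [Ring R]

open Abelian

/-- The class in `Ext^q(M, Y)` of a `q`-cycle of `Hom(M, P)`, for an injective resolution `P`
of `Y`. -/
noncomputable def cyclesToExt [Small.{v} R] {Y : ModuleCat.{v} R} (P : InjectiveResolution Y)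
    (q : ℕ) (M : (ModuleCat.{v} R)ᵒᵖ) :
    ((homComplexFunctor P.cocomplex).obj M).cycles q ⟶
      ((Abelian.extFunctor (C := ModuleCat.{v} R) q).flip.obj Y).obj M :=
  AddCommGrpCat.ofHom <| AddMonoidHom.mk'
    (fun z => P.extMk (X := M.unop) (((homComplexFunctor P.cocomplex).obj M).iCycles q z) (q + 1)
      rfl (ConcreteCategory.congr_hom
        (((homComplexFunctor P.cocomplex).obj M).iCycles_d q (q + 1)) z))
    (fun z z' => by
      have key : ∀ (f f' g : M.unop ⟶ P.cocomplex.X q) (hf : f ≫ P.cocomplex.d q (q + 1) = 0)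
          (hf' : f' ≫ P.cocomplex.d q (q + 1) = 0) (hg : g ≫ P.cocomplex.d q (q + 1) = 0),
          g = f + f' → P.extMk g (q + 1) rfl hg =
            P.extMk f (q + 1) rfl hf + P.extMk f' (q + 1) rfl hf' := by
        rintro f f' _ hf hf' hg rfl
        exact (P.add_extMk f f' _ rfl hf hf').symm
      exact key _ _ _ _ _ _ (map_add
        (((homComplexFunctor P.cocomplex).obj M).iCycles q).hom z z'))

theorem cyclesToExt_eq [Small.{v} R] {Y : ModuleCat.{v} R} (P : InjectiveResolution Y)
    (q : ℕ) (M : (ModuleCat.{v} R)ᵒᵖ) (z) (f : M.unop ⟶ P.cocomplex.X q)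
    (hf : f ≫ P.cocomplex.d q (q + 1) = 0)
    (h : ((homComplexFunctor P.cocomplex).obj M).iCycles q z = f) :
    cyclesToExt P q M z = P.extMk f (q + 1) rfl hf := by
  subst h
  rfl

theorem cyclesToExt_eq_zero_iff [Small.{v} R] {Y : ModuleCat.{v} R} (P : InjectiveResolution Y)
    (q : ℕ) (M : (ModuleCat.{v} R)ᵒᵖ) (z) :
    cyclesToExt P q M z = 0 ↔ ∃ x, ((homComplexFunctor P.cocomplex).obj M).d
      ((ComplexShape.up ℕ).prev q) q x = ((homComplexFunctor P.cocomplex).obj M).iCycles q z := by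
  have hz : ((homComplexFunctor P.cocomplex).obj M).iCycles q z ≫ P.cocomplex.d q (q + 1) = 0 :=
    ConcreteCategory.congr_hom (((homComplexFunctor P.cocomplex).obj M).iCycles_d q (q + 1)) z
  cases q with
  | zero =>
    -- In degree 0 `prev` returns 0 itself, and the differential from 0 to 0 is zero.
    rw [((homComplexFunctor P.cocomplex).obj M).shape _ _ (by simp)]
    exact (P.extMk_zero_eq_zero_iff _ hz).trans ⟨fun h => ⟨0, h.symm⟩, fun ⟨_, h⟩ => h.symm⟩
  | succ q =>
    rw [CochainComplex.prev_nat_succ]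
    exact P.extMk_eq_zero_iff _ _ rfl hz q rfl

theorem cyclesToExt_surjective [Small.{v} R] {Y : ModuleCat.{v} R} (P : InjectiveResolution Y)
    (q : ℕ) (M : (ModuleCat.{v} R)ᵒᵖ) : Function.Surjective (cyclesToExt P q M) := by
  intro e
  obtain ⟨f, hf, rfl⟩ := P.extMk_surjective e (q + 1) rfl
  obtain ⟨z, hz⟩ := exists_iCycles_eq ((homComplexFunctor P.cocomplex).obj M) (q := q) f hf
  exact ⟨z, cyclesToExt_eq P q M z f hf hz⟩

theorem toCycles_comp_cyclesToExt [Small.{v} R] {Y : ModuleCat.{v} R} (P : InjectiveResolution Y)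
    (q : ℕ) (M : (ModuleCat.{v} R)ᵒᵖ) :
    ((homComplexFunctor P.cocomplex).obj M).toCycles ((ComplexShape.up ℕ).prev q) q ≫
      cyclesToExt P q M = 0 := by
  ext x
  refine (cyclesToExt_eq_zero_iff P q M _).2 ⟨x, ?_⟩
  exact ConcreteCategory.congr_hom
    (((homComplexFunctor P.cocomplex).obj M).toCycles_i ((ComplexShape.up ℕ).prev q) q).symm x

/-- The comparison map from the cohomology of `Hom(M, P)` to `Ext(M, Y)`, for an injective
resolution `P` of `Y`. -/
noncomputable def homCohomologyToExt [Small.{v} R] {Y : ModuleCat.{v} R}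
    (P : InjectiveResolution Y) (q : ℕ) (M : (ModuleCat.{v} R)ᵒᵖ) :
    (homCohomology P.cocomplex q).obj M ⟶
      ((Abelian.extFunctor (C := ModuleCat.{v} R) q).flip.obj Y).obj M :=
  (((homComplexFunctor P.cocomplex).obj M).homologyIsCokernel _ q rfl).desc
    (Limits.CokernelCofork.ofπ _ (toCycles_comp_cyclesToExt P q M))

theorem homologyπ_comp_homCohomologyToExt [Small.{v} R] {Y : ModuleCat.{v} R}
    (P : InjectiveResolution Y) (q : ℕ) (M : (ModuleCat.{v} R)ᵒᵖ) :
    ((homComplexFunctor P.cocomplex).obj M).homologyπ q ≫ homCohomologyToExt P q M =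
      cyclesToExt P q M :=
  (((homComplexFunctor P.cocomplex).obj M).homologyIsCokernel _ q rfl).fac
    (Limits.CokernelCofork.ofπ _ (toCycles_comp_cyclesToExt P q M)) Limits.WalkingParallelPair.one

theorem homCohomologyToExt_bijective [Small.{v} R] {Y : ModuleCat.{v} R}
    (P : InjectiveResolution Y) (q : ℕ) (M : (ModuleCat.{v} R)ᵒᵖ) :
    Function.Bijective (homCohomologyToExt P q M) := by
  have happ := ConcreteCategory.congr_hom (homologyπ_comp_homCohomologyToExt P q M)
  refine ⟨(injective_iff_map_eq_zero (homCohomologyToExt P q M).hom).2 fun h hh => ?_, fun e => ?_⟩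
  · obtain ⟨z, rfl⟩ := homologyπ_surjective _ q h
    obtain ⟨x, hx⟩ := (cyclesToExt_eq_zero_iff P q M z).1 ((happ z).symm.trans hh)
    have hz : ((homComplexFunctor P.cocomplex).obj M).toCycles
        ((ComplexShape.up ℕ).prev q) q x = z := by
      apply (AddCommGrpCat.mono_iff_injective
        (((homComplexFunctor P.cocomplex).obj M).iCycles q)).1 inferInstance
      rw [← hx, ← ConcreteCategory.comp_apply, HomologicalComplex.toCycles_i]
    rw [← hz]
    exact ConcreteCategory.congr_hom
      (((homComplexFunctor P.cocomplex).obj M).toCycles_comp_homologyπ _ q) x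
  · obtain ⟨z, rfl⟩ := cyclesToExt_surjective P q M e
    exact ⟨_, happ z⟩

theorem homCohomologyToExt_naturality [Small.{v} R] {Y : ModuleCat.{v} R}
    (P : InjectiveResolution Y) (q : ℕ) {M N : (ModuleCat.{v} R)ᵒᵖ} (f : M ⟶ N) :
    (homCohomology P.cocomplex q).map f ≫ homCohomologyToExt P q N =
      homCohomologyToExt P q M ≫
        ((Abelian.extFunctor (C := ModuleCat.{v} R) q).flip.obj Y).map f := by
  have h1 : ((homComplexFunctor P.cocomplex).obj M).homologyπ q ≫
      (homCohomology P.cocomplex q).map f =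
      HomologicalComplex.cyclesMap ((homComplexFunctor P.cocomplex).map f) q ≫
        ((homComplexFunctor P.cocomplex).obj N).homologyπ q :=
    HomologicalComplex.homologyπ_naturality _ _
  -- Naturality is checked on cycles, where both sides are the class of the cocycle precomposed with
  -- `f`.
  refine (cancel_epi (((homComplexFunctor P.cocomplex).obj M).homologyπ q)).1 ?_
  refine ConcreteCategory.hom_ext _ _ fun z => ?_
  refine (congrArg (homCohomologyToExt P q N) (ConcreteCategory.congr_hom h1 z)).trans ?_
  refine (ConcreteCategory.congr_hom (homologyπ_comp_homCohomologyToExt P q N) _).trans ?_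
  refine Eq.trans ?_ (congrArg (((Abelian.extFunctor (C := ModuleCat.{v} R) q).flip.obj Y).map f)
    (ConcreteCategory.congr_hom (homologyπ_comp_homCohomologyToExt P q M) z).symm)
  have hz : ((homComplexFunctor P.cocomplex).obj M).iCycles q z ≫ P.cocomplex.d q (q + 1) = 0 :=
    ConcreteCategory.congr_hom (((homComplexFunctor P.cocomplex).obj M).iCycles_d q (q + 1)) z
  have h2 := ConcreteCategory.congr_hom (HomologicalComplex.cyclesMap_i
    ((homComplexFunctor P.cocomplex).map f) q) z
  refine (cyclesToExt_eq P q N _ (f.unop ≫ ((homComplexFunctor P.cocomplex).obj M).iCycles q z)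
    ((Category.assoc _ _ _).trans
      ((congrArg (f.unop ≫ ·) hz).trans Limits.comp_zero)) h2).trans ?_
  exact (P.mk₀_comp_extMk _ _ rfl hz f.unop).symm

/-- If `P` is an injective resolution of `Y`, then `Ext(M, Y)` is the cohomology of `Hom(M, P)`,
naturally in `M`. -/
noncomputable def extIsoHomCohomology [Small.{v} R] {Y : ModuleCat.{v} R}
    (P : InjectiveResolution Y) (q : ℕ) :
    (Abelian.extFunctor (C := ModuleCat.{v} R) q).flip.obj Y ≅ homCohomology P.cocomplex q :=
  Iso.symm <| NatIso.ofComponents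
    (fun M => haveI := (ConcreteCategory.isIso_iff_bijective _).2 (homCohomologyToExt_bijective P q M)
      asIso (homCohomologyToExt P q M))
    (fun f => homCohomologyToExt_naturality P q f)

end Resolution

/-! ### The complex of sums as a resolution -/

section SumResolution

variable {R : Type u} [Ring R] {A : Type v} [AddCommGroup A] [Module R A]
  {n : ℕ}

theorem sumComplex_d (I : Fin (n + 1) → Submodule R A) (q : ℕ) :
    (sumComplex I).d q (q + 1) = ModuleCat.ofHom (sumCoboundary I q) :=
  CochainComplex.of_d (fun q => ModuleCat.of R (sumCochains I q))
    (fun q => ModuleCat.ofHom (sumCoboundary I q)) q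

/-- The constant cochains with values in the intersection. -/
def constCochain (I : Fin (n + 1) → Submodule R A) : ↥(⨅ k, I k) →ₗ[R] sumCochains I 0 where
  toFun c := ⟨fun _ => c, fun α => Submodule.mem_iSup_of_mem 0 ((Submodule.mem_iInf _).1 c.2 (α 0)),
    fun _ _ _ h => absurd (Subsingleton.elim (α := Fin 1) _ _) h,
    fun _ _ _ h => absurd (Subsingleton.elim (α := Fin 1) _ _) h⟩
  map_add' _ _ := rfl
  map_smul' _ _ := rfl

theorem sumCoboundary_constCochain (I : Fin (n + 1) → Submodule R A) (c : ↥(⨅ k, I k)) :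
    sumCoboundary I 0 (constCochain I c) = 0 := by
  refine Subtype.ext (funext fun α => ?_)
  change sumCoboundaryAux R A n 0 _ α = 0
  rw [sumCoboundaryAux_apply, Fin.sum_univ_two]
  simp [constCochain]

/-- The augmentation of the complex of sums by the intersection. -/
noncomputable def sumAugmentation (I : Fin (n + 1) → Submodule R A) :
    (CochainComplex.single₀ (ModuleCat.{v} R)).obj (ModuleCat.of R ↥(⨅ k, I k)) ⟶ sumComplex I :=
  (CochainComplex.fromSingle₀Equiv _ _).symm ⟨ModuleCat.ofHom (constCochain I), by
    rw [sumComplex_d]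
    ext c
    exact sumCoboundary_constCochain I c⟩

theorem sumComplex_exactAt_succ (hA : IsDistributiveModule R A) (I : Fin (n + 1) → Submodule R A)
    (q : ℕ) : (sumComplex I).ExactAt (q + 1) := by
  rw [HomologicalComplex.exactAt_iff' _ q (q + 1) (q + 2) (by simp) (by simp),
    ShortComplex.moduleCat_exact_iff]
  rintro ⟨i, hi⟩ hd
  have hd' : sumCoboundary I (q + 1) ⟨i, hi⟩ = 0 :=
    (ConcreteCategory.congr_hom (sumComplex_d I (q + 1)) _).symm.trans hd
  obtain ⟨j, hj, hji⟩ := exists_sumCoboundaryAux_eq hA n I q i hi (congrArg Subtype.val hd')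
  refine ⟨⟨j, hj⟩, ?_⟩
  refine (ConcreteCategory.congr_hom (sumComplex_d I q) _).trans ?_
  exact Subtype.ext hji

theorem quasiIso_sumAugmentation (hA : IsDistributiveModule R A)
    (I : Fin (n + 1) → Submodule R A) : QuasiIso (sumAugmentation I) where
  quasiIsoAt q := by
    cases q with
    | zero =>
      -- In degree 0 the claim becomes left exactness: the augmentation is injective and its image
      -- is the group of 0-cocycles.
      rw [CochainComplex.quasiIsoAt₀_iff, ShortComplex.quasiIso_iff_of_zeros]
      rotate_left
      · rfl
      · rfl
      · exact (sumComplex I).shape _ _ (by simp)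
      constructor
      · rw [ShortComplex.moduleCat_exact_iff]
        rintro ⟨i, hi⟩ hd
        have hd' : sumCoboundary I 0 ⟨i, hi⟩ = 0 :=
          (ConcreteCategory.congr_hom (sumComplex_d I 0) _).symm.trans hd
        obtain ⟨c, hc, h⟩ := sumCochains_zero_cocycle hi (congrArg Subtype.val hd')
        exact ⟨⟨c, hc⟩, Subtype.ext (funext fun α => (h α).symm)⟩
      · rw [ModuleCat.mono_iff_injective]
        intro c c' h
        exact Subtype.ext (congrFun (congrArg Subtype.val h) fun _ => 0)
    | succ q =>
      rw [quasiIsoAt_iff_exactAt _ _ (CochainComplex.exactAt_succ_single_obj _ _)]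
      exact sumComplex_exactAt_succ hA I q

/-- The complex of sums of injective submodules is an injective resolution of their
intersection. -/
noncomputable def sumResolution [Small.{v} R] (hR : IsLeftHereditary R)
    (hA : IsDistributiveModule R A) (I : Fin (n + 1) → Submodule R A)
    (hI : ∀ k, Module.Injective R (I k)) :
    InjectiveResolution (ModuleCat.of R ↥(⨅ k, I k)) where
  cocomplex := sumComplex I
  injective q := by
    have := hR.injective_sumCochains I hI q
    exact Module.injective_object_of_injective_module R (sumCochains I q)
  ι := sumAugmentation I
  quasiIso := quasiIso_sumAugmentation hA I

end SumResolution

theorem corollary4 :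
    (∀ (R : Type u) [Ring R] [Small.{v} R] (A : Type v) [AddCommGroup A] [Module R A]
      (n : ℕ) (I : Fin (n + 1) → Submodule R A),
      IsNoetherianRing R → IsLeftHereditary R → IsDistributiveModule R A →
      (∀ k, Module.Injective R (I k)) →
      ∀ q : ℕ, Nonempty
        ((Abelian.extFunctor (C := ModuleCat.{v} R) q).flip.obj (ModuleCat.of R ↥(⨅ k, I k)) ≅
          homCohomology (sumComplex I) q)) ∧
    (∀ (R : Type u) [CommRing R] [IsDedekindDomain R] [Small.{v} R]
      (A : Type v) [AddCommGroup A] [Module R A]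
      (n : ℕ) (I : Fin (n + 1) → Submodule R A),
      IsDistributiveModule R A → (∀ k, Module.Injective R (I k)) →
      Module.Finite R A → IsNonsingularModule R A →
      ∀ q : ℕ, 0 < q → ∀ M : ModuleCat.{v} R,
        Limits.IsZero ((homCohomology (sumComplex I) q).obj (Opposite.op M))) := by
  refine ⟨fun R _ _ A _ _ n I _ hR hA hI q => ⟨extIsoHomCohomology (sumResolution hR hA I hI) q⟩,
    fun R _ _ _ A _ _ n I hA hI _ hns q hq M => ?_⟩
  obtain ⟨q, rfl⟩ := Nat.exists_eq_succ_of_ne_zero hq.ne'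
  -- The intersection is itself injective, so its `Ext` vanishes in positive degrees, and the
  -- cohomology with it.
  have hinj := hns.injective_iInf I hI
  have : Injective (ModuleCat.of R ↥(⨅ k, I k)) :=
    Module.injective_object_of_injective_module R ↥(⨅ k, I k)
  refine Limits.IsZero.of_iso ?_ ((extIsoHomCohomology
    (sumResolution (IsDedekindDomain.isLeftHereditary R) hA I hI) (q + 1)).app (Opposite.op M)).symm
  refine @AddCommGrpCat.isZero_of_subsingleton _ (subsingleton_of_forall_eq 0 fun e => ?_)
  exact Abelian.Ext.eq_zero_of_injective e
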